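/- Let $G$ be a countably infinite abelian group. A set $S$ of sequences in $G$ is called a $TS$-set if there is a Hausdorff group topology on $G$ in which every sequence of $S$ converges to the neutral element; the finest such topology is then denoted by $\tau_S$, and for a one-element $TS$-set $S=\{\mathbf{u}\}$ one writes $(G,\mathbf{u})$ for $(G,\tau_{\{\mathbf{u}\}})$. For an abelian topological group $X$, let $X^\wedge$ be the group of all continuous characters of $X$ (continuous homomorphisms from $X$ to the circle group) with the compact-open topology. Let $S=\{\mathbf{u}_n : n\in\mathbb{N}\}$ be a $TS$-set of sequences in $G$, enumerated by $\mathbb{N}$ (repetitions allowed). Then $(G,\tau_S)^\wedge$ is a Polish group. More precisely, the product $\prod_{n\in\mathbb{N}}(G,\mathbf{u}_n)^\wedge$ is a Polish group, and $(G,\tau_S)^\wedge$ is isomorphic, as a topological group, to a closed subgroup of it. -/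

import Mathlib

open Filter Topology

/-- All sequences of `S` converge to the neutral element in the Hausdorff group topology `τ`.
The abelian group `G` is written multiplicatively, as in Mathlib's `PontryaginDual`. -/
def IsTSTopology {G : Type*} [CommGroup G] (S : Set (ℕ → G)) (τ : GroupTopology G) : Prop :=
  @T2Space G τ.toTopologicalSpace ∧
    ∀ v ∈ S, Tendsto v atTop (@nhds G τ.toTopologicalSpace 1)

/-- `S` is a `TS`-set of sequences: there is a Hausdorff group topology on `G` in which all
sequences of `S` converge to the neutral element. -/
def IsTSSet {G : Type*} [CommGroup G] (S : Set (ℕ → G)) : Prop :=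
  ∃ τ : GroupTopology G, IsTSTopology S τ

/-- The topology `τ_S`: the infimum of all Hausdorff group topologies in which the sequences of `S`
converge to the neutral element. If `S` is a `TS`-set it is the finest such topology
(`isLeast_tsTopology`; in Mathlib `τ ≤ σ` means that `τ` is finer than `σ`). -/
def tsTopology {G : Type*} [CommGroup G] (S : Set (ℕ → G)) : GroupTopology G :=
  sInf {τ | IsTSTopology S τ}

theorem isLeast_tsTopology {G : Type*} [CommGroup G] {S : Set (ℕ → G)} (hS : IsTSSet S) :
    IsLeast {τ | IsTSTopology S τ} (tsTopology S) := by
  refine ⟨⟨?_, fun v hv => ?_⟩, fun τ hτ => sInf_le hτ⟩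
  · obtain ⟨τ, hτ⟩ := hS
    have hle : (tsTopology S).toTopologicalSpace ≤ τ.toTopologicalSpace :=
      GroupTopology.toTopologicalSpace_le.2 (sInf_le hτ)
    exact t2Space_antitone hle hτ.1
  · rw [tsTopology, GroupTopology.toTopologicalSpace_sInf, nhds_sInf]
    refine tendsto_iInf.2 fun t => tendsto_iInf.2 ?_
    rintro ⟨τ, hτ, rfl⟩
    exact hτ.2 v hv

/-- The topological group `(G, τ_S)`, as a type synonym of `G`. For a single sequence `v`, the group
`(G, v)` is `TSGroup {v}`. -/
def TSGroup {G : Type*} (_S : Set (ℕ → G)) : Type _ := G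

instance {G : Type*} [CommGroup G] (S : Set (ℕ → G)) : CommGroup (TSGroup S) :=
  inferInstanceAs (CommGroup G)

instance {G : Type*} [CommGroup G] (S : Set (ℕ → G)) : TopologicalSpace (TSGroup S) :=
  (tsTopology S).toTopologicalSpace

instance {G : Type*} [CommGroup G] (S : Set (ℕ → G)) : IsTopologicalGroup (TSGroup S) :=
  (tsTopology S).toIsTopologicalGroup

open Set TopologicalSpace

/-! A character is recorded by its values on `G` and its restrictions to the convergent sequences `u
i`, an element of a Polish group (`tsEval`). The image is closed, since characters continuous for
`τ_S` are exactly those tending to 1 along each `u i` (`range_tsEval`). The inverse is continuous by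
Baire category: compact subsets of `G` are countable, hence metrizable, so pointwise continuity
suffices (`continuous_of_continuous_eval`). For the product, this embedding factors through
restriction to the `(G, u n)`. -/

theorem secondCountableTopology_of_countable_compact {K : Type*} [TopologicalSpace K]
    [CompactSpace K] [T2Space K] [Countable K] : SecondCountableTopology K := by
  have hsep (p : {p : K × K // p.1 ≠ p.2}) : ∃ f : C(K, ℝ), f p.1.1 ≠ f p.1.2 := by
    obtain ⟨f, h0, h1, -⟩ := exists_continuous_zero_one_of_isClosed
      (isClosed_singleton (x := p.1.1)) (isClosed_singleton (x := p.1.2))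
      (disjoint_singleton.2 p.2)
    exact ⟨f, by simp [h0 (mem_singleton _), h1 (mem_singleton _)]⟩
  choose f hf using hsep
  have hcont : Continuous fun (x : K) p => f p x := by fun_prop
  have hinj : Function.Injective fun (x : K) p => f p x := fun x y hxy => by
    by_contra hne
    exact hf ⟨(x, y), hne⟩ (congrFun hxy _)
  exact (hcont.isClosedEmbedding hinj).isInducing.secondCountableTopology

instance : PolishSpace C(OnePoint ℕ, Circle) :=
  have : SecondCountableTopology (OnePoint ℕ) := by
    have : Countable (OnePoint ℕ) := inferInstanceAs (Countable (Option ℕ))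
    exact secondCountableTopology_of_countable_compact
  have : IsCompletelyMetrizableSpace C(OnePoint ℕ, Circle) :=
    ⟨ContinuousMap.instMetricSpace _, rfl,
      ContinuousMap.instCompleteSpaceOfCompactlyCoherentSpace⟩
  inferInstance

instance : PolishSpace Circle :=
  have : IsCompletelyMetrizableSpace Circle :=
    ⟨Circle.instMetricSpace, rfl, complete_of_compact⟩
  inferInstance

theorem Circle.dist_mul_left_cancel (a b c : Circle) : dist (a * b) (a * c) = dist b c := by
  change dist (a * b : ℂ) (a * c) = dist (b : ℂ) c
  rw [dist_eq_norm, dist_eq_norm, ← mul_sub, norm_mul, Circle.norm_coe, one_mul]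

/-- A homomorphism from a Baire group to the group of circle-valued functions on a compact second
countable space is continuous as soon as it is pointwise continuous. -/
theorem continuous_of_continuous_eval {H K : Type*} [Group H] [TopologicalSpace H]
    [IsTopologicalGroup H] [BaireSpace H] [TopologicalSpace K] [CompactSpace K]
    [SecondCountableTopology K] [LocallyCompactSpace K] (φ : H →* C(K, Circle))
    (hφ : ∀ k, Continuous fun h => φ h k) : Continuous φ := by
  refine continuous_of_continuousAt_one φ ?_
  rw [ContinuousAt, map_one, Metric.nhds_basis_closedBall.tendsto_right_iff]
  intro ε hε
  -- Countably many sets cover `H`; each is closed because a sup-norm bound is a family of pointwise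
  -- bounds. By Baire, one has interior.
  let C : ℕ → Set H := fun n => φ ⁻¹' Metric.closedBall (denseSeq C(K, Circle) n) (ε / 2)
  have hC n : IsClosed (C n) := by
    have : C n = ⋂ k, {h | dist (φ h k) (denseSeq C(K, Circle) n k) ≤ ε / 2} := by
      ext h
      simp [C, ContinuousMap.dist_le (half_pos hε).le]
    rw [this]
    exact isClosed_iInter fun k => isClosed_le ((hφ k).dist continuous_const) continuous_const
  have hcover : ⋃ n, C n = univ := by
    refine eq_univ_of_forall fun h => mem_iUnion.2 ?_
    obtain ⟨n, hn⟩ := (denseRange_denseSeq C(K, Circle)).exists_dist_lt (φ h) (half_pos hε)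
    exact ⟨n, hn.le⟩
  obtain ⟨n, h₀, hh₀⟩ := nonempty_interior_of_iUnion_of_closed hC hcover
  have hmem : ∀ᶠ h in 𝓝 (1 : H), h₀ * h ∈ C n := by
    have : Tendsto (fun h => h₀ * h) (𝓝 1) (𝓝 h₀) := by
      simpa using (continuous_const_mul h₀).tendsto 1
    exact this.eventually (mem_interior_iff_mem_nhds.1 hh₀)
  filter_upwards [hmem] with h hh
  have hh₁ : h₀ ∈ C n := interior_subset hh₀
  have hdist : dist (φ (h₀ * h)) (φ h₀) ≤ ε :=
    (dist_triangle_right _ _ _).trans ((add_le_add hh hh₁).trans_eq (add_halves ε))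
  refine (ContinuousMap.dist_le hε.le).2 fun k => ?_
  rw [← Circle.dist_mul_left_cancel (φ h₀ k)]
  simpa using (ContinuousMap.dist_le hε.le).1 hdist k

section TSGroup

variable {G : Type*} [CommGroup G]

theorem IsTSSet.mono {S T : Set (ℕ → G)} (hT : IsTSSet T) (h : S ⊆ T) : IsTSSet S :=
  hT.imp fun _ hτ => ⟨hτ.1, fun v hv => hτ.2 v (h hv)⟩

theorem IsTSSet.t2Space {S : Set (ℕ → G)} (hS : IsTSSet S) : T2Space (TSGroup S) :=
  (isLeast_tsTopology hS).1.1

theorem IsTSSet.tendsto {S : Set (ℕ → G)} (hS : IsTSSet S) {v : ℕ → G} (hv : v ∈ S) :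
    Tendsto (β := TSGroup S) v atTop (𝓝 1) :=
  (isLeast_tsTopology hS).1.2 v hv

/-- A homomorphism to a topological group is continuous for `τ_S` as soon as it maps the sequences
of `S` to sequences converging to the neutral element. -/
theorem IsTSSet.continuous_of_tendsto {S : Set (ℕ → G)} (hS : IsTSSet S) {H : Type*} [Group H]
    [TopologicalSpace H] [IsTopologicalGroup H] (χ : TSGroup S →* H)
    (hχ : ∀ v ∈ S, Tendsto (fun k => χ (v k)) atTop (𝓝 1)) : Continuous χ := by
  let σ : GroupTopology G := ⟨.induced χ inferInstance, topologicalGroup_induced χ⟩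
  -- Refining `τ_S` by the topology induced by `χ` preserves both requirements, so minimality puts
  -- `τ_S` below `σ`.
  have hσ : IsTSTopology S (tsTopology S ⊓ σ) := by
    obtain ⟨hT2, hconv⟩ := (isLeast_tsTopology hS).1
    refine ⟨t2Space_antitone (GroupTopology.toTopologicalSpace_le.2 inf_le_left) hT2,
      fun v hv => ?_⟩
    rw [GroupTopology.toTopologicalSpace_inf, nhds_inf]
    refine tendsto_inf.2 ⟨hconv v hv, ?_⟩
    have : @nhds G σ.toTopologicalSpace 1 = comap χ (𝓝 (χ 1)) :=
      @nhds_induced H G _ χ 1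
    rw [this]
    refine tendsto_comap_iff.2 ?_
    rw [map_one]
    exact hχ v hv
  exact continuous_iff_le_induced.2 (GroupTopology.toTopologicalSpace_le.2
    (((isLeast_tsTopology hS).2 hσ).trans inf_le_right))

/-- The convergent sequence `v` as a map on the one-point compactification of `ℕ`. -/
noncomputable def IsTSSet.seqMap {S : Set (ℕ → G)} (hS : IsTSSet S) {v : ℕ → G} (hv : v ∈ S) :
    C(OnePoint ℕ, TSGroup S) :=
  OnePoint.continuousMapMkNat v 1 (hS.tendsto hv)

variable {ι : Type*} {u : ι → ℕ → G}

/-- A character, restricted to the sequences `u i` and evaluated at the points of `G`. -/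
noncomputable def tsEval (hS : IsTSSet (range u)) : PontryaginDual (TSGroup (range u)) →*
    (ι → C(OnePoint ℕ, Circle)) × (G → Circle) where
  toFun χ := (fun i => (ContinuousMonoidHom.toContinuousMap χ).comp (hS.seqMap (mem_range_self i)),
    χ)
  map_one' := rfl
  map_mul' _ _ := rfl

theorem continuous_dual_eval {S : Set (ℕ → G)} (g : TSGroup S) :
    Continuous fun χ : PontryaginDual (TSGroup S) => χ g :=
  (continuous_eval_const (F := C(TSGroup S, Circle)) g).comp
    (ContinuousMonoidHom.isInducing_toContinuousMap _ _).continuous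

theorem continuous_tsEval (hS : IsTSSet (range u)) : Continuous (tsEval hS) := by
  have h : Continuous fun χ : PontryaginDual (TSGroup (range u)) =>
      ContinuousMonoidHom.toContinuousMap χ :=
    (ContinuousMonoidHom.isInducing_toContinuousMap _ _).continuous
  exact (continuous_pi fun i => (ContinuousMap.continuous_precomp _).comp h).prodMk
    (continuous_pi continuous_dual_eval)

theorem tsEval_injective (hS : IsTSSet (range u)) : Function.Injective (tsEval hS) :=
  fun _ _ h => PontryaginDual.ext (congrFun (congrArg Prod.snd h))

/-- The conditions do not mention continuity on `G`: continuity of `p.1 i` at infinity supplies it.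
Each is an equation between continuous functions of `p`, so the range is closed. -/
theorem range_tsEval (hS : IsTSSet (range u)) : range (tsEval hS) =
    {p | (∀ a b, p.2 (a * b) = p.2 a * p.2 b) ∧
      ∀ i, (∀ k : ℕ, p.1 i k = p.2 (u i k)) ∧ p.1 i OnePoint.infty = 1} := by
  ext p
  constructor
  · rintro ⟨χ, rfl⟩
    exact ⟨fun a b => map_mul χ a b, fun i => ⟨fun k => rfl, map_one χ⟩⟩
  · rintro ⟨hmul, hseq⟩
    let ψ : TSGroup (range u) →* Circle := MonoidHom.mk' p.2 hmul
    have hψ : Continuous ψ := by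
      refine hS.continuous_of_tendsto ψ ?_
      rintro _ ⟨i, rfl⟩
      have hlim := (OnePoint.continuous_iff_from_nat _).1 (p.1 i).continuous
      rw [(hseq i).2] at hlim
      exact hlim.congr (hseq i).1
    refine ⟨(⟨ψ, hψ⟩ : TSGroup (range u) →ₜ* Circle), Prod.ext (funext fun i => ?_) rfl⟩
    ext x
    induction x using OnePoint.rec with
    | infty => exact congrArg Subtype.val ((map_one ψ).trans (hseq i).2.symm)
    | coe k => exact congrArg Subtype.val ((hseq i).1 k).symm

theorem isClosed_range_tsEval (hS : IsTSSet (range u)) : IsClosed (range (tsEval hS)) := by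
  rw [range_tsEval]
  simp only [ofPred_and, ofPred_forall]
  refine .inter (isClosed_iInter fun a => isClosed_iInter fun b => ?_) (isClosed_iInter fun i =>
    .inter (isClosed_iInter fun k => ?_) ?_)
  all_goals exact isClosed_eq (by fun_prop) (by fun_prop)

theorem isClosedEmbedding_tsEval [Countable G] [Countable ι] (hS : IsTSSet (range u)) :
    IsClosedEmbedding (tsEval hS) := by
  let e : PontryaginDual (TSGroup (range u)) ≃* (tsEval hS).range :=
    MonoidHom.ofInjective (tsEval_injective hS)
  have hclosed : IsClosed ((tsEval hS).range : Set ((ι → C(OnePoint ℕ, Circle)) × (G → Circle))) := isClosed_range_tsEval hS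
  have : PolishSpace (tsEval hS).range := hclosed.polishSpace
  let := upgradeIsCompletelyMetrizable (tsEval hS).range
  have he : Continuous e := (continuous_tsEval hS).subtype_mk _
  have hsymm : Continuous e.symm := by
    refine (ContinuousMonoidHom.isInducing_toContinuousMap _ _).continuous_iff.2 ?_
    refine continuous_iff_continuousAt.2 fun x =>
      (ContinuousMap.tendsto_compactOpen_iff_forall _ _).2 fun K hK => ?_
    have := isCompact_iff_compactSpace.1 hK
    have := hS.t2Space
    have : Countable (TSGroup (range u)) := inferInstanceAs (Countable G)
    have : SecondCountableTopology K := secondCountableTopology_of_countable_compact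
    let φ : (tsEval hS).range →* C(K, Circle) := MonoidHom.mk'
      (fun r => (ContinuousMonoidHom.toContinuousMap (e.symm r)).restrict K) fun a b => by
        ext k
        simp only [map_mul]
        rfl
    refine (continuous_of_continuous_eval φ fun k => ?_).continuousAt
    have hφ (r : (tsEval hS).range) : φ r k = r.1.2 k.1 :=
      congrFun (congrArg (fun s : (tsEval hS).range => s.1.2) (e.apply_symm_apply r)) k.1
    simp only [hφ]
    exact (continuous_apply (A := fun _ : G => Circle) k.1).comp
      (continuous_snd.comp continuous_subtype_val)
  exact hclosed.isClosedEmbedding_subtypeVal.comp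
    (⟨e.toEquiv, he, hsymm⟩ : _ ≃ₜ (tsEval hS).range).isClosedEmbedding

theorem IsTSSet.polishSpace_pontryaginDual [Countable G] {S : Set (ℕ → G)} (hS : IsTSSet S)
    (hc : S.Countable) : PolishSpace (PontryaginDual (TSGroup S)) := by
  have := hc.to_subtype
  obtain ⟨ι, v, hι, rfl⟩ : ∃ (ι : Type _) (v : ι → ℕ → G), Countable ι ∧ range v = S :=
    ⟨S, Subtype.val, inferInstance, Subtype.range_coe⟩
  exact (isClosedEmbedding_tsEval hS).polishSpace

/-- The identity map from the finer to the coarser group. -/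
def IsTSSet.idHom {S T : Set (ℕ → G)} (hT : IsTSSet T) (h : S ⊆ T) : TSGroup S →ₜ* TSGroup T where
  toMonoidHom := MonoidHom.id G
  continuous_toFun := (hT.mono h).continuous_of_tendsto (H := TSGroup T) (MonoidHom.id G)
    fun _ hv => hT.tendsto (h hv)

end TSGroup

theorem theorem1p10 {G : Type*} [CommGroup G] [Countable G] [Infinite G]
    (u : ℕ → ℕ → G) (hS : IsTSSet (Set.range u)) :
    PolishSpace (PontryaginDual (TSGroup (Set.range u))) ∧
    PolishSpace (∀ n, PontryaginDual (TSGroup {u n})) ∧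
    ∃ f : PontryaginDual (TSGroup (Set.range u)) →* (∀ n, PontryaginDual (TSGroup {u n})),
      IsClosedEmbedding f := by
  have hsub n : {u n} ⊆ range u := singleton_subset_iff.2 (mem_range_self n)
  have hpol (n : ℕ) : PolishSpace (PontryaginDual (TSGroup {u n})) :=
    (hS.mono (hsub n)).polishSpace_pontryaginDual (countable_singleton _)
  refine ⟨hS.polishSpace_pontryaginDual (countable_range u), inferInstance, ?_⟩
  let f : PontryaginDual (TSGroup (range u)) →* (∀ n, PontryaginDual (TSGroup {u n})) :=
    MonoidHom.pi fun n => (PontryaginDual.map (hS.idHom (hsub n))).toMonoidHom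
  have hf : Continuous f :=
    continuous_pi fun n => (PontryaginDual.map (hS.idHom (hsub n))).continuous_toFun
  have hres n : Continuous fun χ : PontryaginDual (TSGroup {u n}) =>
      (ContinuousMonoidHom.toContinuousMap χ).comp
        ((hS.mono (hsub n)).seqMap (mem_singleton (u n))) :=
    (ContinuousMap.continuous_precomp _).comp
      (ContinuousMonoidHom.isInducing_toContinuousMap _ _).continuous
  -- On the image of `f` all components agree as functions on `G`, so index 0 is an arbitrary
  -- choice.
  let q : (∀ n, PontryaginDual (TSGroup {u n})) → (ℕ → C(OnePoint ℕ, Circle)) × (G → Circle) :=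
    fun χ => (fun n => (ContinuousMonoidHom.toContinuousMap (χ n)).comp
      ((hS.mono (hsub n)).seqMap (mem_singleton (u n))), fun g : G => χ 0 g)
  have hq : Continuous q :=
    (continuous_pi fun n => (hres n).comp (continuous_apply n)).prodMk
      (continuous_pi fun g => (continuous_dual_eval (S := {u 0}) g).comp (continuous_apply 0))
  have hqf : q ∘ f = tsEval hS := rfl
  have hemb : IsClosedEmbedding (q ∘ f) := hqf ▸ isClosedEmbedding_tsEval hS
  -- Since `q ∘ f` is proper and the product is Hausdorff, `f` is proper, hence closed.
  exact ⟨f, .of_continuous_injective_isClosedMap hf hemb.injective.of_comp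
    (isProperMap_of_comp_of_t2 hf hq hemb.isProperMap).isClosedMap⟩
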